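/- Fix $q\in\mathbb C$ with $|q|<1$ and put $$\vartheta(x)=(x^{1/2}-x^{-1/2})\prod_{s\ge 1}(1-q^{s}x)(1-q^{s}/x).$$ All multiplicative variables are given through logarithms, which makes $\vartheta$ single-valued: if $x=e^{w}$ then $x^{1/2}=e^{w/2}$, and products of variables correspond to sums of logarithms; $\vartheta'(1)$ is the derivative at $x=1$ of the branch with $1^{1/2}=1$. **Elliptic classes.** Let $[n]=\{1,\dots,n\}$ and let $\lambda=(\lambda_1,\dots,\lambda_N)$ be nonnegative integers with sum $n$; put $\lambda^{(k)}=\lambda_1+\dots+\lambda_k$. Let $\mathcal I_\lambda$ be the set of ordered partitions $I=(I_1,\dots,I_N)$ of $[n]$ with $|I_j|=\lambda_j$; it indexes the Schubert cells $\Omega_I$ and the torus fixed points $x_I$ of the partial flag variety $\mathcal F_\lambda$ of flags $V_1\subset\dots\subset V_{N-1}\subset\mathbb C^n$, $\dim V_k=\lambda^{(k)}$. Let $I^{(k)}=I_1\cup\dots\cup I_k=\{i^{(k)}_1<\dots<i^{(k)}_{\lambda^{(k)}}\}$, $p(I,j,i)=|I_j\cap\{1,\dots,i-1\}|$, let $\dim_I$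 be the number of pairs $(a,b)\in I_j\times I_k$ with $j<k$ and $a>b$, and for $i=i^{(k)}_a\in I_j$ let $y_{I,k,a}=\frac{\mu_{k+1}}{\mu_j}\hbar^{1+p(I,j,i)-p(I,k+1,i)}$. Put $$\psi_{I,k,a,b}(x)=\begin{cases}\vartheta(x\hbar)/\vartheta(\hbar)& i^{(k+1)}_b<i^{(k)}_a\\ \vartheta(x\,y_{I,k,a})/\vartheta(y_{I,k,a})& i^{(k+1)}_b=i^{(k)}_a\\ \vartheta(x)& i^{(k+1)}_b>i^{(k)}_a,\end{cases}$$ $$U_I=\vartheta'(1)^{\dim_I}\prod_{k=1}^{N-1}\Bigl(\prod_{a=1}^{\lambda^{(k)}}\prod_{b=1}^{\lambda^{(k+1)}}\psi_{I,k,a,b}\bigl(t^{(k+1)}_b/t^{(k)}_a\bigr)\prod_{a<b\le\lambda^{(k)}}\frac1{\vartheta(t^{(k)}_b/t^{(k)}_a)}\prod_{b<a\le\lambda^{(k)}}\frac{\vartheta(\hbar)}{\vartheta(\hbar t^{(k)}_b/t^{(k)}_a)}\Bigr),\qquad t^{(N)}_a=z_a,$$ and let the elliptic weight function $W_I$ be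 the sum of $U_I$ over all permutations of the variables within each group $t^{(k)}_1,\dots,t^{(k)}_{\lambda^{(k)}}$, $1\le k\le N-1$. The elliptic class $E(\Omega_I)$ of the Schubert cell $\Omega_I$ is the tuple of its restrictions to the fixed points, where $E(\Omega_I)|_{x_J}$ is $W_I$ with $t^{(k)}_a=z_{j^{(k)}_a}$. The structure constants $c_{I,J}^K$ are defined by $E(\Omega_I)E(\Omega_J)=\sum_{K}c_{I,J}^K E(\Omega_K)$, as an identity at every fixed point. **Theorem.** Let $\lambda=(1,n-1)$, so that $\mathcal F_\lambda$ is the projective space $\mathbb P^{n-1}$ of lines in $\mathbb C^n$; for $k\in[n]$ let $I_k=(\{k\},[n]\setminus\{k\})$ and write $c_{k,l}^m=c_{I_k,I_l}^{I_m}$. Let the parameters $z_1,\dots,z_n,\mu_1,\mu_2,\hbar$ be generic in the sense that $\vartheta(\hbar)\ne0$, $\vartheta(\tfrac{\mu_2}{\mu_1}\hbar^{2-l})\neq0$ for all $l\in[n]$, and $\vartheta(z_j/z_i)\ne0$, $\vartheta(z_i\hbar/z_j)\ne0$ for all $1\le i<j\le n$. Then the structure constants exist and are uniquely determined, and for all $k\le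 l$ in $[n]$ we have $c_{k,l}^m=0$ for every $m>k$, and $$c_{k,l}^{k}=\vartheta'(1)^{l-1}\,\frac{\vartheta\bigl(\frac{z_l}{z_k}\cdot\frac{\mu_2}{\mu_1}\cdot\hbar^{2-l}\bigr)}{\vartheta\bigl(\frac{\mu_2}{\mu_1}\cdot\hbar^{2-l}\bigr)}\prod_{i=1}^{l-1}\frac{\vartheta(z_i\hbar/z_k)}{\vartheta(\hbar)}\prod_{i=l+1}^{n}\vartheta(z_i/z_k).$$ In particular, for every $k\in[n]$, $$c_{k,k}^{k}=\vartheta'(1)^{k-1}\prod_{i=1}^{k-1}\frac{\vartheta(z_i\hbar/z_k)}{\vartheta(\hbar)}\prod_{i=k+1}^{n}\vartheta(z_i/z_k).$$ -/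

import Mathlib

noncomputable section

namespace EllipticSchubert

/-! ### Theta functions

The function `ϑ(x) = (x^{1/2} - x^{-1/2}) ∏_{s ≥ 1} (1 - q^s x)(1 - q^s / x)` is two-valued in `x`.
All multiplicative variables are therefore lifted to their logarithms: `theta q w` is the value
`ϑ(e^w)`, with `x^{1/2} = e^{w/2}`. Products of variables become sums of logarithms. -/

/-- `theta q w = ϑ(e^w)`, a single-valued function of `w`. -/
def theta (q w : ℂ) : ℂ :=
  (Complex.exp (w / 2) - Complex.exp (-(w / 2))) *
    ∏' s : ℕ, ((1 - q ^ (s + 1) * Complex.exp w) * (1 - q ^ (s + 1) / Complex.exp w))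

/-- `ϑ'(1)`: the derivative at `x = 1` of `x ↦ ϑ(x)`, for the branch with `1^{1/2} = 1`. -/
def thetaPrimeOne (q : ℂ) : ℂ :=
  deriv (fun x : ℂ => theta q (Complex.log x)) 1

/-! ### Combinatorics of a partial flag variety

`lam : Fin (N + 1) → ℕ` is the list `λ_1, …, λ_{N+1}` of block sizes (at least one block); the flag
variety parametrizes flags `V_1 ⊂ … ⊂ V_N ⊂ ℂⁿ` with `dim V_j = λ_1 + … + λ_j`. -/

/-- The partial sum `λ^{(k)} = ∑_{i ≤ k} λ_i`. -/
def stepDim {N : ℕ} (lam : Fin (N + 1) → ℕ) (k : Fin (N + 1)) : ℕ :=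
  ∑ i ∈ Finset.Iic k, lam i

/-- Ordered set partitions `I = (I_1, …, I_{N+1})` of `[n]` with `|I_j| = λ_j`. Such a partition is
given by the map sending `i` to the index `j` of the block `I_j` containing `i`. These index both
the Schubert cells and the torus fixed points. -/
abbrev Index {N : ℕ} (n : ℕ) (lam : Fin (N + 1) → ℕ) : Type :=
  {f : Fin n → Fin (N + 1) // ∀ j, (Finset.univ.filter (fun i => f i = j)).card = lam j}

namespace Index

variable {N n : ℕ} {lam : Fin (N + 1) → ℕ}

/-- The index `j` of the block `I_j` that contains `i`. -/
def block (I : Index n lam) (i : Fin n) : Fin (N + 1) := I.1 i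

/-- The union `I^{(k)} = I_1 ∪ … ∪ I_k`. -/
def upper (I : Index n lam) (k : Fin (N + 1)) : Finset (Fin n) :=
  Finset.univ.filter (fun i => I.block i ≤ k)

theorem card_upper (I : Index n lam) (k : Fin (N + 1)) :
    (I.upper k).card = stepDim lam k := by
  unfold stepDim upper block
  rw [Finset.card_eq_sum_card_fiberwise (f := I.1) (t := Finset.Iic k)
    (fun i hi => by simpa using hi)]
  refine Finset.sum_congr rfl fun j hj => ?_
  rw [← I.2 j, Finset.filter_filter]
  congr 1
  ext i
  simp only [Finset.mem_Iic] at hj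
  simp only [Finset.mem_filter, Finset.mem_univ, true_and]
  exact ⟨fun h => h.2, fun h => ⟨h ▸ hj, h⟩⟩

/-- The increasing enumeration `i^{(k)}_1 < i^{(k)}_2 < …` of `I^{(k)}`. -/
def enum (I : Index n lam) (k : Fin (N + 1)) : Fin (stepDim lam k) ↪o Fin n :=
  (I.upper k).orderEmbOfFin (I.card_upper k)

/-- `dim_I`, the number of pairs `(a, b) ∈ I_j × I_k` with `j < k` and `a > b`; this is the
dimension of the Schubert cell of `I`. -/
def dim (I : Index n lam) : ℕ :=
  (Finset.univ.filter
    (fun ab : Fin n × Fin n => I.block ab.1 < I.block ab.2 ∧ ab.2 < ab.1)).card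

/-- `p(I, j, i) = |I_j ∩ {1, …, i - 1}|`. -/
def p (I : Index n lam) (j : Fin (N + 1)) (i : Fin n) : ℕ :=
  (Finset.univ.filter (fun i' : Fin n => I.block i' = j ∧ i' < i)).card

end Index

/-! ### Elliptic weight functions

The logarithmic variables are `t` (Chern roots), `z` (equivariant), `μ` (dynamical) and `h`
(for `ħ`). -/

section Weight

variable {N n : ℕ} {lam : Fin (N + 1) → ℕ}

/-- The variables `t^{(j)}_b` for all levels `j`, with `t^{(N+1)}_b = z_b` on the top level (there
`I^{(N+1)} = [n]`, so that the `b`-th element of `I^{(N+1)}` is `b`). -/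
def levelVar (I : Index n lam) (z : Fin n → ℂ)
    (t : (k : Fin N) → Fin (stepDim lam k.castSucc) → ℂ) :
    (j : Fin (N + 1)) → Fin (stepDim lam j) → ℂ :=
  Fin.lastCases (motive := fun j => Fin (stepDim lam j) → ℂ)
    (fun b => z (I.enum (Fin.last N) b)) (fun k => t k)

/-- The logarithm of `(μ_{k+1} / μ_j) ħ^{1 + p(I, j, i) - p(I, k+1, i)}`, where `i ∈ I_j`. -/
def dynamicalShift (μ : Fin (N + 1) → ℂ) (h : ℂ) (I : Index n lam) (k : Fin N) (i : Fin n) : ℂ :=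
  μ k.succ - μ (I.block i) +
    ((1 + (I.p (I.block i) i : ℤ) - (I.p k.succ i : ℤ) : ℤ) : ℂ) * h

/-- The factor `ψ_{I,k,a,b}(e^x)`. -/
def psi (q : ℂ) (μ : Fin (N + 1) → ℂ) (h : ℂ) (I : Index n lam) (k : Fin N)
    (a : Fin (stepDim lam k.castSucc)) (b : Fin (stepDim lam k.succ)) (x : ℂ) : ℂ :=
  if I.enum k.succ b < I.enum k.castSucc a then
    theta q (x + h) / theta q h
  else if I.enum k.succ b = I.enum k.castSucc a then
    theta q (x + dynamicalShift μ h I k (I.enum k.castSucc a)) /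
      theta q (dynamicalShift μ h I k (I.enum k.castSucc a))
  else theta q x

/-- The function `U_I` before symmetrization. -/
def preWeight (q : ℂ) (z : Fin n → ℂ) (μ : Fin (N + 1) → ℂ) (h : ℂ) (I : Index n lam)
    (t : (k : Fin N) → Fin (stepDim lam k.castSucc) → ℂ) : ℂ :=
  thetaPrimeOne q ^ I.dim *
    ∏ k : Fin N,
      ((∏ a : Fin (stepDim lam k.castSucc), ∏ b : Fin (stepDim lam k.succ),
          psi q μ h I k a b (levelVar I z t k.succ b - t k a)) *
        (∏ a : Fin (stepDim lam k.castSucc), ∏ b ∈ Finset.Ioi a,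
          1 / theta q (t k b - t k a)) *
        (∏ a : Fin (stepDim lam k.castSucc), ∏ b ∈ Finset.Iio a,
          theta q h / theta q (h + t k b - t k a)))

/-- The elliptic weight function `W_I = W_{id,I}`: the symmetrization of `U_I` in each group of
variables `t^{(k)}`. -/
def weight (q : ℂ) (z : Fin n → ℂ) (μ : Fin (N + 1) → ℂ) (h : ℂ) (I : Index n lam)
    (t : (k : Fin N) → Fin (stepDim lam k.castSucc) → ℂ) : ℂ :=
  ∑ σ : (k : Fin N) → Equiv.Perm (Fin (stepDim lam k.castSucc)),
    preWeight q z μ h I (fun k a => t k (σ k a))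

/-- The restriction `E(Ω_I)|_{x_J} = W_I(z_J)` of the elliptic class of the Schubert cell of `I` to
the fixed point of `J`: the substitution of `z_{j^{(k)}_a}` for `t^{(k)}_a`. An elliptic class is
the tuple of its restrictions to the fixed points. -/
def ellipticClass (q : ℂ) (z : Fin n → ℂ) (μ : Fin (N + 1) → ℂ) (h : ℂ)
    (I J : Index n lam) : ℂ :=
  weight q z μ h I (fun k a => z (J.enum k.castSucc a))

/-- `c` is an array of structure constants for the elliptic classes of the Schubert cells:
`E(Ω_I) · E(Ω_J) = ∑_K c_{I,J}^K E(Ω_K)`, an identity between tuples indexed by the fixed points. -/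
def IsStructureConstants (q : ℂ) (z : Fin n → ℂ) (μ : Fin (N + 1) → ℂ) (h : ℂ)
    (c : Index n lam → Index n lam → Index n lam → ℂ) : Prop :=
  ∀ I J L : Index n lam,
    ellipticClass q z μ h I L * ellipticClass q z μ h J L =
      ∑ K : Index n lam, c I J K * ellipticClass q z μ h K L

end Weight

/-! ### The projective space of lines in `ℂⁿ` -/

/-- `I_k = ({k}, [n] - {k})`. -/
def projIndex {n : ℕ} (k : Fin n) : Index n ![1, n - 1] :=
  ⟨fun i => if i = k then 0 else 1, by
    intro j
    fin_cases j
    · simp [Finset.filter_eq']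
    · simp [Finset.filter_ne', Finset.card_erase_of_mem]⟩

end EllipticSchubert

end

open EllipticSchubert

/-! Restriction of Schubert classes to fixed points is triangular. On projective space there is one
Chern root, so `E(Ω_k)|_{x_m}` is a single product, and for `m > k` it contains the factor
`ϑ(z_m/z_m) = 0`. On the diagonal it is a product of powers of `ϑ'(1)` and theta values that are
nonzero by genericity. The restriction matrix `M` is therefore invertible, so the structure
constants exist and are unique. The product `E(Ω_k)E(Ω_l)` vanishes at `x_m` for `m > k` because its
first factor does, so back substitution (`vecMul_triangular`) kills `c_{k,l}^m` for these `m`. At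
`x_k` what remains is `c_{k,l}^k E(Ω_k)|_{x_k} = E(Ω_k)|_{x_k} E(Ω_l)|_{x_k}`. Cancelling gives
`c_{k,l}^k = E(Ω_l)|_{x_k}`, which `ellipticClass_projIndex` computes. The analytic input is `ϑ'(1)
= ∏ (1 - q^s)^2 ≠ 0`. -/

namespace EllipticSchubert

/-! ### The theta function near `x = 1` -/

section Theta

variable {q : ℂ}

theorem theta_zero (q : ℂ) : theta q 0 = 0 := by
  simp [theta]

/-- The factor of the infinite product in `theta`, written as `1 + u`. -/
theorem theta_factor_eq (q w : ℂ) (s : ℕ) :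
    (1 - q ^ (s + 1) * Complex.exp w) * (1 - q ^ (s + 1) / Complex.exp w) =
      1 + q ^ (s + 1) * (q ^ (s + 1) - Complex.exp w - Complex.exp (-w)) := by
  rw [Complex.exp_neg]
  field_simp [Complex.exp_ne_zero w]
  ring

/-- The product converges uniformly by the Weierstrass test. Only continuity at `w = 0` is needed
later, and the unit ball is a convenient compact neighbourhood. -/
theorem continuousOn_theta_tprod (hq : ‖q‖ < 1) :
    ContinuousOn (fun w : ℂ => ∏' s : ℕ,
      ((1 - q ^ (s + 1) * Complex.exp w) * (1 - q ^ (s + 1) / Complex.exp w)))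
      (Metric.closedBall 0 1) := by
  simp_rw [theta_factor_eq]
  -- For `‖w‖ ≤ 1` the three terms in the bracket are bounded by `1`, `e` and `e`.
  have hu : Summable fun s : ℕ => ‖q‖ ^ (s + 1) * (1 + Real.exp 1 + Real.exp 1) :=
    ((summable_nat_add_iff 1).2
      (summable_geometric_of_lt_one (norm_nonneg q) hq)).mul_right _
  have key := Summable.hasProdUniformlyOn_nat_one_add
    (f := fun (s : ℕ) (w : ℂ) => q ^ (s + 1) * (q ^ (s + 1) - Complex.exp w - Complex.exp (-w)))
    (isCompact_closedBall (0 : ℂ) 1) hu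
    (Filter.Eventually.of_forall fun s w hw => ?_) (fun s => by fun_prop)
  · rw [hasProdUniformlyOn_iff_tendstoUniformlyOn] at key
    exact key.continuousOn (Filter.Eventually.of_forall fun t => by fun_prop).frequently
  · have hw : ‖w‖ ≤ 1 := by simpa using hw
    have hexp : ∀ v : ℂ, ‖v‖ ≤ 1 → ‖Complex.exp v‖ ≤ Real.exp 1 := fun v hv => by
      rw [Complex.norm_exp]
      exact Real.exp_le_exp.2 ((Complex.re_le_norm v).trans hv)
    rw [norm_mul, norm_pow]
    gcongr
    refine (norm_sub_le _ _).trans (add_le_add ((norm_sub_le _ _).trans (add_le_add ?_ ?_)) ?_)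
    · rw [norm_pow]
      exact pow_le_one₀ (norm_nonneg q) hq.le
    · exact hexp w hw
    · exact hexp (-w) (by simpa using hw)

/-- Each factor is `(1 - q^{s+1})^2 ≠ 0`, and an absolutely convergent product of nonzero factors is
nonzero. -/
theorem theta_tprod_zero_ne_zero (hq : ‖q‖ < 1) :
    ∏' s : ℕ, ((1 - q ^ (s + 1) * Complex.exp 0) * (1 - q ^ (s + 1) / Complex.exp 0)) ≠ 0 := by
  have hs : ∀ s : ℕ, ‖q ^ (s + 1)‖ < 1 := fun s => by
    rw [norm_pow]
    exact pow_lt_one₀ (norm_nonneg q) hq (Nat.succ_ne_zero s)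
  have hne : ∀ s : ℕ, 1 - q ^ (s + 1) ≠ 0 := fun s h => by
    have := hs s
    rw [← sub_eq_zero.1 h] at this
    simp at this
  have hne' : ∀ s : ℕ,
      1 + q ^ (s + 1) * (q ^ (s + 1) - Complex.exp 0 - Complex.exp (-0)) ≠ 0 := fun s => by
    rw [← theta_factor_eq]
    simpa using hne s
  simp_rw [theta_factor_eq]
  refine tprod_one_add_ne_zero_of_summable hne' ?_
  refine Summable.of_nonneg_of_le (fun _ => norm_nonneg _) (fun s => ?_)
    (((summable_nat_add_iff 1).2
      (summable_geometric_of_lt_one (norm_nonneg q) hq)).mul_right (1 + 1 + 1))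
  rw [norm_mul, norm_pow]
  gcongr
  refine (norm_sub_le _ _).trans (add_le_add ((norm_sub_le _ _).trans (add_le_add ?_ ?_)) ?_)
  · exact (hs s).le
  · simp
  · simp

/-- The prefactor vanishes at `x = 1` with derivative `1/2 + 1/2 = 1`, so the infinite product only
has to be continuous there, not differentiable. -/
theorem thetaPrimeOne_eq (hq : ‖q‖ < 1) :
    thetaPrimeOne q = ∏' s : ℕ,
      ((1 - q ^ (s + 1) * Complex.exp 0) * (1 - q ^ (s + 1) / Complex.exp 0)) := by
  set P : ℂ → ℂ := fun w => ∏' s : ℕ,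
    ((1 - q ^ (s + 1) * Complex.exp w) * (1 - q ^ (s + 1) / Complex.exp w)) with hP
  have hlog : HasDerivAt Complex.log 1 1 := by
    simpa using Complex.hasDerivAt_log Complex.one_mem_slitPlane
  have hPc : ContinuousAt (fun x => P (Complex.log x)) 1 := by
    refine ContinuousAt.comp (g := P) ?_ hlog.continuousAt
    rw [Complex.log_one]
    exact (continuousOn_theta_tprod hq).continuousAt (Metric.closedBall_mem_nhds 0 one_pos)
  have hg : HasDerivAt
      (fun x => Complex.exp (Complex.log x / 2) - Complex.exp (-(Complex.log x / 2))) 1 1 := by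
    have h1 := (hlog.div_const 2).cexp
    have h2 := (hlog.div_const 2).neg.cexp
    refine (h1.sub h2).congr_deriv ?_
    norm_num [Complex.log_one]
  have hd : HasDerivAt (fun x => theta q (Complex.log x)) (P 0) 1 := by
    rw [hasDerivAt_iff_tendsto_slope] at hg ⊢
    -- Since the prefactor is zero at `1`, the slope of the whole function is the slope of the
    -- prefactor times the product at `log x`.
    have hlim := hg.mul (hPc.tendsto.mono_left nhdsWithin_le_nhds)
    rw [Complex.log_one, one_mul] at hlim
    refine hlim.congr fun x => ?_
    simp [slope_def_field, theta, hP]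
    ring
  exact hd.deriv

theorem thetaPrimeOne_ne_zero (hq : ‖q‖ < 1) : thetaPrimeOne q ≠ 0 := by
  rw [thetaPrimeOne_eq hq]
  exact theta_tprod_zero_ne_zero hq

end Theta

/-! ### Enumerations of the sets `I^{(k)}` -/

section Index

variable {N n : ℕ} {lam : Fin (N + 1) → ℕ}

theorem Index.range_enum (I : Index n lam) (k : Fin (N + 1)) :
    Set.range (I.enum k) = I.upper k :=
  Finset.range_orderEmbOfFin _ _

theorem Index.prod_enum (I : Index n lam) (k : Fin (N + 1)) (f : Fin n → ℂ) :
    ∏ b, f (I.enum k b) = ∏ i ∈ I.upper k, f i := by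
  have : I.upper k = Finset.univ.map (I.enum k).toEmbedding := by
    apply Finset.coe_injective
    simp [← I.range_enum k]
  rw [this, Finset.prod_map]
  rfl

theorem Index.upper_last (I : Index n lam) : I.upper (Fin.last N) = Finset.univ := by
  simp [Index.upper, Fin.le_last]

theorem levelVar_last (I : Index n lam) (z : Fin n → ℂ)
    (t : (k : Fin N) → Fin (stepDim lam k.castSucc) → ℂ) (b) :
    levelVar I z t (Fin.last N) b = z (I.enum (Fin.last N) b) := by
  simp [levelVar]

end Index

/-! ### Restrictions of elliptic classes on projective space -/

section Projective

variable {n : ℕ}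

theorem stepDim_proj_zero (n : ℕ) : stepDim ![1, n - 1] 0 = 1 := by
  rw [stepDim, show Finset.Iic (0 : Fin 2) = {0} from rfl, Finset.sum_singleton]
  rfl

theorem projIndex_block (k i : Fin n) : (projIndex k).block i = if i = k then 0 else 1 := rfl

theorem projIndex_upper_zero (k : Fin n) : (projIndex k).upper 0 = {k} := by
  ext i
  by_cases hi : i = k <;> simp [Index.upper, projIndex_block, hi]

theorem projIndex_enum_zero (k : Fin n) (a) : (projIndex k).enum 0 a = k := by
  have : (projIndex k).enum 0 a ∈ (projIndex k).upper 0 := Finset.orderEmbOfFin_mem _ _ _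
  simpa [projIndex_upper_zero] using this

theorem projIndex_dim (k : Fin n) : (projIndex k).dim = k := by
  have : (Finset.univ.filter (fun ab : Fin n × Fin n =>
      (projIndex k).block ab.1 < (projIndex k).block ab.2 ∧ ab.2 < ab.1)) =
      {k} ×ˢ Finset.Iio k := by
    ext ⟨a, b⟩
    rw [Finset.mem_filter_univ]
    by_cases ha : a = k <;> by_cases hb : b = k <;> simp [projIndex_block, ha, hb]
    exact fun _ h => ha h.symm
  rw [Index.dim, this]
  simp

theorem projIndex_p_zero (k : Fin n) : (projIndex k).p 0 k = 0 := by
  simp only [Index.p, Finset.card_eq_zero]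
  ext i
  by_cases hi : i = k <;> simp [projIndex_block, hi]

theorem projIndex_p_one (k : Fin n) : (projIndex k).p 1 k = k := by
  have : (Finset.univ.filter fun i => (projIndex k).block i = 1 ∧ i < k) = Finset.Iio k := by
    ext i
    by_cases hi : i = k <;> simp [projIndex_block, hi]
  rw [Index.p, this, Fin.card_Iio]

/-- With `k` counted from `0`, the exponent of `ħ` is `1 + 0 - k = 2 - (k + 1)`. -/
theorem projIndex_dynamicalShift (μ : Fin 2 → ℂ) (h : ℂ) (k : Fin n) :
    dynamicalShift μ h (projIndex k) 0 k = μ 1 - μ 0 + (2 - ((k : ℕ) + 1 : ℂ)) * h := by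
  have hb : (projIndex k).block k = 0 := by simp [projIndex_block]
  simp only [dynamicalShift, hb, projIndex_p_zero, Fin.succ_zero_eq_one, projIndex_p_one]
  push_cast
  ring

/-- A partition of type `(1, n - 1)` is determined by the element of its first block. -/
theorem projIndex_bijective (n : ℕ) : Function.Bijective (projIndex (n := n)) := by
  constructor
  · intro k l hkl
    have := congrArg (fun I => Index.upper I 0) hkl
    simpa [projIndex_upper_zero] using this
  · intro I
    have hI : (I.upper 0).card = 1 := (I.card_upper 0).trans (stepDim_proj_zero n)
    obtain ⟨k, hk⟩ := Finset.card_eq_one.1 hI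
    refine ⟨k, Subtype.ext (funext fun i => ?_)⟩
    have hi : i ∈ I.upper 0 ↔ i = k := by rw [hk, Finset.mem_singleton]
    rw [Index.upper, Finset.mem_filter_univ, Index.block] at hi
    change (if i = k then (0 : Fin 2) else 1) = I.1 i
    by_cases hik : i = k
    · rw [if_pos hik]
      exact (Fin.le_zero_iff.1 (hi.2 hik)).symm
    · rw [if_neg hik]
      exact (Fin.eq_one_of_ne_zero _ fun h0 => hik (hi.1 h0.le)).symm

/-- The restrictions of the elliptic classes of Schubert cells of projective space. -/
theorem ellipticClass_projIndex (q : ℂ) (z : Fin n → ℂ) (μ : Fin 2 → ℂ) (h : ℂ) (k m : Fin n) :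
    ellipticClass q z μ h (projIndex k) (projIndex m) =
      thetaPrimeOne q ^ (k : ℕ) *
        (theta q (z k - z m + (μ 1 - μ 0) + (2 - ((k : ℕ) + 1 : ℂ)) * h) /
          theta q (μ 1 - μ 0 + (2 - ((k : ℕ) + 1 : ℂ)) * h)) *
        (∏ i ∈ Finset.Iio k, theta q (z i + h - z m) / theta q h) *
        ∏ i ∈ Finset.Ioi k, theta q (z i - z m) := by
  -- There is only one variable `t`, so the symmetrization has a single term and both products over
  -- pairs of variables are empty.
  have hU : Unique (Fin (stepDim ![1, n - 1] (Fin.castSucc (0 : Fin 1)))) :=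
    (finCongr (stepDim_proj_zero n)).unique
  have hS : ∀ j : Fin 1, Subsingleton (Fin (stepDim ![1, n - 1] j.castSucc)) := fun j => by
    rw [Subsingleton.elim j 0]; infer_instance
  have : Unique ((j : Fin 1) → Equiv.Perm (Fin (stepDim ![1, n - 1] j.castSucc))) :=
    { default := 1, uniq := fun σ => funext fun j => Subsingleton.elim _ _ }
  have hIoi : ∀ a : Fin (stepDim ![1, n - 1] (Fin.castSucc (0 : Fin 1))), Finset.Ioi a = ∅ :=
    fun a => by ext b; simp [Subsingleton.elim b a]
  have hIio : ∀ a : Fin (stepDim ![1, n - 1] (Fin.castSucc (0 : Fin 1))), Finset.Iio a = ∅ :=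
    fun a => by ext b; simp [Subsingleton.elim b a]
  have henum : ∀ (k : Fin n) (a), (projIndex k).enum (Fin.castSucc (0 : Fin 1)) a = k :=
    projIndex_enum_zero
  have hlev : ∀ t b, levelVar (projIndex k) z t (Fin.succ (0 : Fin 1)) b =
      z ((projIndex k).enum (Fin.succ (0 : Fin 1)) b) := fun t b => levelVar_last _ _ _ _
  have hup : (projIndex k).upper (Fin.succ (0 : Fin 1)) = Finset.univ := Index.upper_last _
  rw [ellipticClass, weight, Fintype.sum_unique, preWeight, projIndex_dim, Fin.prod_univ_one]
  simp only [hIoi, hIio, Finset.prod_empty, Finset.prod_const_one, mul_one, Fintype.prod_unique,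
    psi, hlev, henum]
  -- The top level enumerates all of `[n]`, so the product over `b` becomes one over `i`. It is then
  -- split at `i = k` into the three cases of `psi`.
  rw [Index.prod_enum (projIndex k) (Fin.succ (0 : Fin 1)) (fun i =>
    if i < k then theta q (z i - z m + h) / theta q h
    else if i = k then theta q (z i - z m + dynamicalShift μ h (projIndex k) 0 k) /
      theta q (dynamicalShift μ h (projIndex k) 0 k)
    else theta q (z i - z m)), hup, projIndex_dynamicalShift]
  have huniv : (Finset.univ : Finset (Fin n)) =
      (Finset.Iio k ∪ {k}) ∪ Finset.Ioi k := by
    ext i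
    have := lt_trichotomy i k
    simp only [Finset.mem_univ, Finset.mem_union, Finset.mem_Iio, Finset.mem_singleton,
      Finset.mem_Ioi, true_iff]
    tauto
  rw [huniv, Finset.prod_union, Finset.prod_union, Finset.prod_singleton]
  · have h1 : ∀ i ∈ Finset.Iio k, (if i < k then theta q (z i - z m + h) / theta q h
        else if i = k then theta q (z i - z m + (μ 1 - μ 0 + (2 - ((k : ℕ) + 1 : ℂ)) * h)) /
          theta q (μ 1 - μ 0 + (2 - ((k : ℕ) + 1 : ℂ)) * h)
        else theta q (z i - z m)) = theta q (z i + h - z m) / theta q h := fun i hi => by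
      rw [if_pos (Finset.mem_Iio.1 hi), sub_add_eq_add_sub]
    have h2 : ∀ i ∈ Finset.Ioi k, (if i < k then theta q (z i - z m + h) / theta q h
        else if i = k then theta q (z i - z m + (μ 1 - μ 0 + (2 - ((k : ℕ) + 1 : ℂ)) * h)) /
          theta q (μ 1 - μ 0 + (2 - ((k : ℕ) + 1 : ℂ)) * h)
        else theta q (z i - z m)) = theta q (z i - z m) := fun i hi => by
      have hi := Finset.mem_Ioi.1 hi
      rw [if_neg hi.not_gt, if_neg hi.ne']
    rw [Finset.prod_congr rfl h1, Finset.prod_congr rfl h2, if_neg (lt_irrefl k), if_pos rfl,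
      ← add_assoc]
    ring
  · simp
  · rw [Finset.disjoint_left]
    intro i hi
    simp only [Finset.mem_union, Finset.mem_Iio, Finset.mem_singleton] at hi
    simpa using le_of_lt_or_eq hi

theorem ellipticClass_projIndex_eq_zero (q : ℂ) (z : Fin n → ℂ) (μ : Fin 2 → ℂ) (h : ℂ)
    {k m : Fin n} (hkm : k < m) :
    ellipticClass q z μ h (projIndex k) (projIndex m) = 0 := by
  rw [ellipticClass_projIndex,
    Finset.prod_eq_zero (Finset.mem_Ioi.2 hkm) (by rw [sub_self, theta_zero]), mul_zero]

theorem ellipticClass_projIndex_self {q : ℂ} (z : Fin n → ℂ) (μ : Fin 2 → ℂ) (h : ℂ) (k : Fin n)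
    (hμ : theta q (μ 1 - μ 0 + (2 - ((k : ℕ) + 1 : ℂ)) * h) ≠ 0) :
    ellipticClass q z μ h (projIndex k) (projIndex k) =
      thetaPrimeOne q ^ (k : ℕ) *
        (∏ i ∈ Finset.Iio k, theta q (z i + h - z k) / theta q h) *
        ∏ i ∈ Finset.Ioi k, theta q (z i - z k) := by
  rw [ellipticClass_projIndex, sub_self, zero_add, div_self hμ, mul_one]

end Projective

/-- Back substitution in a lower triangular linear system. -/
theorem vecMul_triangular {n : ℕ} {M : Matrix (Fin n) (Fin n) ℂ}
    (hM : ∀ i j, i < j → M i j = 0) (hd : ∀ i, M i i ≠ 0) {v f : Fin n → ℂ}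
    (hv : Matrix.vecMul v M = f) (k : Fin n) (hf : ∀ j, k < j → f j = 0) :
    (∀ j, k < j → v j = 0) ∧ v k * M k k = f k := by
  -- In `∑ i, v i * M i j` the terms `i < j` vanish by triangularity and the terms `i > j` by the
  -- assumption on `v`.
  have step : ∀ j, (∀ i, j < i → v i = 0) → v j * M j j = f j := fun j hj => by
    rw [← hv, Matrix.vecMul, dotProduct, Finset.sum_eq_single j]
    · intro i _ hij
      rcases lt_or_gt_of_ne hij with hlt | hgt
      · rw [hM i j hlt, mul_zero]
      · rw [hj i hgt, zero_mul]
    · simp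
  -- Induction downwards from the largest index.
  have zero : ∀ j, k < j → v j = 0 := fun j => by
    induction j using WellFoundedGT.induction with
    | ind j ih =>
      intro hkj
      have := step j fun i hi => ih i hi (hkj.trans hi)
      rw [hf j hkj] at this
      exact (mul_eq_zero.1 this).resolve_right (hd j)
  exact ⟨zero, step k zero⟩

end EllipticSchubert

/-- Here `n` is the number of homogeneous coordinates, and `z i`, `μ j`, `h` are logarithms of
`z_{i+1}`, `μ_{j+1}`, `ħ`. An index `l : Fin n` stands for the number `l + 1` in `{1, …, n}`. -/
theorem mainTheorem6 (n : ℕ) (q : ℂ) (hq : ‖q‖ < 1)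
    (z : Fin n → ℂ) (μ : Fin 2 → ℂ) (h : ℂ)
    (h_h : theta q h ≠ 0)
    (h_mu : ∀ l : Fin n,
      theta q (μ 1 - μ 0 + (2 - ((l : ℕ) + 1 : ℂ)) * h) ≠ 0)
    (h_z : ∀ i j : Fin n, i < j → theta q (z j - z i) ≠ 0)
    (h_zh : ∀ i j : Fin n, i < j → theta q (z i + h - z j) ≠ 0) :
    (∃! c : Index n ![1, n - 1] → Index n ![1, n - 1] →
        Index n ![1, n - 1] → ℂ,
      IsStructureConstants q z μ h c) ∧
    ∀ c : Index n ![1, n - 1] → Index n ![1, n - 1] →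
        Index n ![1, n - 1] → ℂ,
      IsStructureConstants q z μ h c →
      (∀ k l : Fin n, k ≤ l →
        (∀ m : Fin n, k < m →
          c (projIndex k) (projIndex l)
            (projIndex m) = 0) ∧
        c (projIndex k) (projIndex l)
            (projIndex k) =
          thetaPrimeOne q ^ ((l : ℕ) + 1 - 1) *
            (theta q
                (z l - z k + (μ 1 - μ 0) + (2 - ((l : ℕ) + 1 : ℂ)) * h) /
              theta q (μ 1 - μ 0 + (2 - ((l : ℕ) + 1 : ℂ)) * h)) *
            (∏ i ∈ Finset.Iio l,
              theta q (z i + h - z k) / theta q h) *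
            ∏ i ∈ Finset.Ioi l, theta q (z i - z k)) ∧
      (∀ k : Fin n,
        c (projIndex k) (projIndex k)
            (projIndex k) =
          thetaPrimeOne q ^ ((k : ℕ) + 1 - 1) *
            (∏ i ∈ Finset.Iio k,
              theta q (z i + h - z k) / theta q h) *
            ∏ i ∈ Finset.Ioi k, theta q (z i - z k)) := by
  have hT := thetaPrimeOne_ne_zero hq
  set M : Matrix (Fin n) (Fin n) ℂ := Matrix.of fun i j =>
    ellipticClass q z μ h (projIndex i) (projIndex j) with hMdef
  have hM : ∀ i j, i < j → M i j = 0 := fun i j hij =>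
    ellipticClass_projIndex_eq_zero q z μ h hij
  have hd : ∀ i, M i i ≠ 0 := fun i => by
    refine (ellipticClass_projIndex_self z μ h i (h_mu i)).trans_ne ?_
    refine mul_ne_zero (mul_ne_zero (pow_ne_zero _ hT) ?_) ?_
    · exact Finset.prod_ne_zero_iff.2 fun j hj =>
        div_ne_zero (h_zh j i (Finset.mem_Iio.1 hj)) h_h
    · exact Finset.prod_ne_zero_iff.2 fun j hj => h_z i j (Finset.mem_Ioi.1 hj)
  have hdet : IsUnit M.det := by
    rw [Matrix.det_of_isLowerTriangular M fun i j hij => hM i j (OrderDual.toDual_lt_toDual.1 hij)]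
    exact (Finset.prod_ne_zero_iff.2 fun i _ => hd i).isUnit
  let e := Equiv.ofBijective _ (projIndex_bijective n)
  let f : Index n ![1, n - 1] → Index n ![1, n - 1] → Fin n → ℂ := fun I J m =>
    ellipticClass q z μ h I (e m) * ellipticClass q z μ h J (e m)
  -- For fixed `I, J` the defining identity at all fixed points is one linear system with matrix
  -- `M`, whose unknown is a row vector.
  have hiff : ∀ c : Index n ![1, n - 1] → Index n ![1, n - 1] → Index n ![1, n - 1] → ℂ,
      IsStructureConstants q z μ h c ↔
        ∀ I J, Matrix.vecMul (fun m => c I J (e m)) M = f I J := fun c => by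
    refine forall₂_congr fun I J => ?_
    rw [e.surjective.forall, funext_iff]
    refine forall_congr' fun m => ?_
    rw [eq_comm, ← e.sum_comp]
    rfl
  refine ⟨⟨fun I J K => Matrix.vecMul (f I J) M⁻¹ (e.symm K), ?_, ?_⟩, ?_⟩
  · refine (hiff _).2 fun I J => ?_
    simp only [Equiv.symm_apply_apply]
    change Matrix.vecMul (Matrix.vecMul (f I J) M⁻¹) M = f I J
    rw [Matrix.vecMul_vecMul, Matrix.nonsing_inv_mul _ hdet, Matrix.vecMul_one]
  · intro c hc
    funext I J K
    rw [← (hiff c).1 hc I J, Matrix.vecMul_vecMul, Matrix.mul_nonsing_inv _ hdet,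
      Matrix.vecMul_one, Equiv.apply_symm_apply]
  · intro c hc
    have key : ∀ k l : Fin n, k ≤ l →
        (∀ m, k < m → c (projIndex k) (projIndex l) (projIndex m) = 0) ∧
        c (projIndex k) (projIndex l) (projIndex k) =
          -- The right-hand side of the system at `x_j` is `M k j` times the restriction of the
          -- second class: zero for `k < j`, and at `j = k` the factor `M k k` cancels.
          ellipticClass q z μ h (projIndex l) (projIndex k) := fun k l _ => by
      obtain ⟨h0, h1⟩ := vecMul_triangular hM hd
        ((hiff c).1 hc (projIndex k) (projIndex l)) k fun j hj =>
          mul_eq_zero_of_left (hM k j hj) _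
      refine ⟨h0, mul_right_cancel₀ (hd k) (h1.trans (mul_comm _ _))⟩
    refine ⟨fun k l hkl => ⟨(key k l hkl).1, ?_⟩, fun k => ?_⟩
    · rw [(key k l hkl).2, ellipticClass_projIndex, Nat.add_sub_cancel]
    · rw [(key k k le_rfl).2, ellipticClass_projIndex_self z μ h k (h_mu k), Nat.add_sub_cancel]
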